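/- Let $n\ge 0$ and let $\Omega\subsetneq\mathbb C^n$ be a proper open subset. Write $d(z,\Omega^c)$ for the Euclidean distance from $z$ to $\Omega^c=\mathbb C^n\setminus\Omega$, and $S\subset\subset\Omega$ if the closure of $S$ is compact and contained in $\Omega$. A function $u:V\to[-\infty,\infty)$ on an open set $V\subset\mathbb C$ is subharmonic if it is upper semicontinuous and, for every compact $K\subset V$ and every continuous $h:K\to\mathbb R$ which is harmonic in the interior of $K$ and satisfies $u\le h$ on $\partial K$, one has $u\le h$ on $K$. A function $u:\Omega\to[-\infty,\infty)$ is plurisubharmonic if it is upper semicontinuous and, for all $z,w\in\mathbb C^n$, the function $\tau\mapsto u(z+\tau w)$ is subharmonic on $\{\tau\in\mathbb C: z+\tau w\in\Omega\}$. Let $P(\Omega)$ be the set of plurisubharmonic functions in $\Omega$, and for compact $K\subset\Omega$ let $\hat K^P_\Omega=\{z\in\Omega: u(z)\le\sup_K u \text{ for all } u\in P(\Omega)\}$. Then the following conditions are equivalent: (i) $z\mapsto-\log d(z,\Omega^c)$ is plurisubharmonic in $\Omega$; (ii) there is a continuous plurisubharmonic function $u:\Omega\to\mathbb R$ such that $\{z\in\Omega: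 u(z)<c\}\subset\subset\Omega$ for every $c\in\mathbb R$; (iii) $\hat K^P_\Omega\subset\subset\Omega$ for every compact $K\subset\Omega$. Consequently, if an open subset of $\mathbb C^n$ is called pseudoconvex when it is all of $\mathbb C^n$ or satisfies (i), then for the proper open set $\Omega$ each of (i), (ii), (iii) is equivalent to pseudoconvexity of $\Omega$. -/

import Mathlib

/-- `u` is subharmonic in the open set `Ω ⊆ ℂ`: it takes values in `[-∞, ∞)` on `Ω`, it is upper
semicontinuous on `Ω`, and for every compact `K ⊆ Ω` and every continuous real function `h` on `K`
that is harmonic in the interior of `K`, if `u ≤ h` on the boundary of `K` then `u ≤ h` on `K`.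
Only the values of `u` on `Ω` matter. The function `-∞` is subharmonic. -/
def IsSubharmonicOn (u : ℂ → EReal) (Ω : Set ℂ) : Prop :=
  (∀ z ∈ Ω, u z < ⊤) ∧
  UpperSemicontinuousOn u Ω ∧
  ∀ K : Set ℂ, IsCompact K → K ⊆ Ω →
    ∀ h : ℂ → ℝ, ContinuousOn h K → InnerProductSpace.HarmonicOnNhd h (interior K) →
      (∀ z ∈ frontier K, u z ≤ (h z : EReal)) → ∀ z ∈ K, u z ≤ (h z : EReal)

/-- `u` is plurisubharmonic in the open set `Ω ⊆ ℂⁿ`: it takes values in `[-∞, ∞)` on `Ω`, it is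
upper semicontinuous on `Ω`, and for all `z, w ∈ ℂⁿ` the function `τ ↦ u (z + τ w)` is subharmonic
in the part of `ℂ` where it is defined. Only the values of `u` on `Ω` matter. -/
def IsPlurisubharmonicOn {n : ℕ} (u : EuclideanSpace ℂ (Fin n) → EReal)
    (Ω : Set (EuclideanSpace ℂ (Fin n))) : Prop :=
  (∀ z ∈ Ω, u z < ⊤) ∧
  UpperSemicontinuousOn u Ω ∧
  ∀ z w : EuclideanSpace ℂ (Fin n),
    IsSubharmonicOn (fun τ : ℂ => u (z + τ • w)) {τ : ℂ | z + τ • w ∈ Ω}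

/-- The plurisubharmonic hull of `K` in `Ω`: all `z ∈ Ω` with `u z ≤ sup_K u` for every
plurisubharmonic function `u` in `Ω` (the supremum is taken in `[-∞, ∞]`). -/
def plurisubharmonicHull {n : ℕ} (Ω K : Set (EuclideanSpace ℂ (Fin n))) :
    Set (EuclideanSpace ℂ (Fin n)) :=
  {z ∈ Ω | ∀ u : EuclideanSpace ℂ (Fin n) → EReal,
    IsPlurisubharmonicOn u Ω → u z ≤ ⨆ x ∈ K, u x}

/-- `S ⊂⊂ Ω`: the closure of `S` is compact and contained in `Ω`. -/
def IsRelativelyCompactIn {X : Type*} [TopologicalSpace X] (S Ω : Set X) : Prop :=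
  IsCompact (closure S) ∧ closure S ⊆ Ω

/-- The function `z ↦ -log d(z, Ωᶜ)`, with the Euclidean distance. -/
noncomputable def negLogDistCompl {n : ℕ} (Ω : Set (EuclideanSpace ℂ (Fin n)))
    (z : EuclideanSpace ℂ (Fin n)) : ℝ :=
  -Real.log (Metric.infDist z Ωᶜ)

/-- An open set `Ω ⊆ ℂⁿ` is pseudoconvex if it is all of `ℂⁿ` or if `-log d(z, Ωᶜ)` is
plurisubharmonic in `Ω`. -/
def IsPseudoconvex {n : ℕ} (Ω : Set (EuclideanSpace ℂ (Fin n))) : Prop :=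
  IsOpen Ω ∧
    (Ω = Set.univ ∨ IsPlurisubharmonicOn (fun z => (negLogDistCompl Ω z : EReal)) Ω)

open Metric Set Filter Topology

/-! From (i), `max (-log d) ‖z‖` is an exhaustion, and the hull of `K` lies in a sublevel set of any
exhaustion, which gives (iii). The substance is (iii) → (i), by Hartogs discs. Let `-log d ≤ Re F`
on the boundary circle of a disc in `Ω` on a complex line. For `‖a‖ < 1`, shift the disc by `exp
(-F) • (l • a)`, `0 ≤ l ≤ 1`. All shifted boundaries lie in one compact `K ⊆ Ω`, so by the maximum
principle a shifted disc inside `Ω` lies in the hull of `K`. Hence the set of good `l` is open and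
closed, `l = 1` is reached, and at the centre `d ≥ exp (-Re F)`.

The shifted discs are curved, while plurisubharmonicity tests complex lines only and `u` is merely
semicontinuous. `IsPlurisubharmonicOn.le_of_le_on_sphere` bridges this without smoothing: the point
of `Ω` and the disc parameter vary independently, coupled by a penalty `k * ‖z - φ τ‖ ^ 2`, and at a
maximum the disc can be replaced by its tangent line. -/

/-! ### Subharmonicity tested on discs -/

/-- The cross term is the real part of a function holomorphic in `a`, so on a circle about `b` the
squared distance to `c` agrees with a harmonic function. -/
theorem Complex.sq_norm_sub_eq (a b c : ℂ) :
    ‖a - c‖ ^ 2 = ‖a - b‖ ^ 2 + 2 * (starRingEnd ℂ (b - c) * (a - b)).re + ‖b - c‖ ^ 2 := by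
  simp only [← Complex.normSq_eq_norm_sq, Complex.normSq_apply, Complex.mul_re, Complex.conj_re,
    Complex.conj_im, Complex.sub_re, Complex.sub_im]
  ring

/-- A continuous function which at the centre of every disc is dominated by the real parts of
analytic functions dominating it on the circle is dominated by harmonic functions. -/
theorem le_harmonic_of_le_re_analytic {v h : ℂ → ℝ} {K : Set ℂ} (hK : IsCompact K)
    (hv : ContinuousOn v K) (hh : ContinuousOn h K)
    (hharm : InnerProductSpace.HarmonicOnNhd h (interior K))
    (hloc : ∀ (c : ℂ) (r : ℝ), 0 < r → closedBall c r ⊆ K →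
      ∀ F : ℂ → ℂ, AnalyticOnNhd ℂ F (closedBall c r) →
        (∀ τ ∈ sphere c r, v τ ≤ (F τ).re) → v c ≤ (F c).re)
    (hfr : ∀ z ∈ frontier K, v z ≤ h z) : ∀ z ∈ K, v z ≤ h z := by
  intro b hb
  by_contra! hlt
  obtain ⟨R, hR⟩ := hK.isBounded.subset_closedBall b
  set m := v b - h b with hm
  have hm0 : 0 < m := sub_pos.2 hlt
  -- Small enough that the perturbation `ε * ‖τ - b‖ ^ 2` stays below `m` on `K`, which keeps the
  -- maximum off the frontier.
  set ε := m / (R ^ 2 + 1) with hε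
  have hε0 : 0 < ε := by positivity
  have hεR : ε * R ^ 2 < m := by
    have : ε * (R ^ 2 + 1) = m := by rw [hε]; field_simp
    nlinarith
  have hg : ContinuousOn (fun τ => v τ - h τ + ε * ‖τ - b‖ ^ 2) K :=
    (hv.sub hh).add (by fun_prop)
  obtain ⟨c, hcK, hc⟩ := hK.exists_isMaxOn ⟨b, hb⟩ hg
  have hc' : ∀ τ ∈ K, v τ - h τ + ε * ‖τ - b‖ ^ 2 ≤ v c - h c + ε * ‖c - b‖ ^ 2 := hc
  have hcint : c ∈ interior K := by
    by_contra hni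
    have h1 := hfr c (by rw [hK.isClosed.frontier_eq]; exact ⟨hcK, hni⟩)
    have h2 := hc' b hb
    have h3 : ‖c - b‖ ≤ R := by simpa [dist_eq_norm] using hR hcK
    have h4 : ‖c - b‖ ^ 2 ≤ R ^ 2 := by gcongr
    simp only [sub_self, norm_zero] at h2
    nlinarith
  obtain ⟨r', hr', hball⟩ := Metric.isOpen_iff.1 isOpen_interior c hcint
  obtain ⟨F, hF, hFre⟩ := InnerProductSpace.HarmonicOnNhd.exists_analyticOnNhd_ball_re_eq
    (hharm.mono hball)
  set r := r' / 2 with hr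
  have hr0 : 0 < r := by positivity
  have hsub : closedBall c r ⊆ ball c r' := closedBall_subset_ball (by linarith)
  have hre : ∀ τ ∈ closedBall c r, (F τ).re = h τ := fun τ hτ => hFre (hsub hτ)
  -- The correction turns the bound from maximality on the circle into the real part of an analytic
  -- function; at the centre it falls short of `v c` by `ε * r ^ 2`.
  have key := hloc c r hr0 (hsub.trans (hball.trans interior_subset))
    (fun τ => F τ + (((v c - h c - ε * r ^ 2 : ℝ) : ℂ)
      - ((2 * ε : ℝ) : ℂ) * (starRingEnd ℂ (c - b) * (τ - c))))
    (fun τ hτ => (hF τ (hsub hτ)).add (by fun_prop)) ?_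
  · rw [Complex.add_re, hre c (mem_closedBall_self hr0.le)] at key
    simp only [sub_self, mul_zero, sub_zero, Complex.ofReal_re] at key
    nlinarith [pow_pos hr0 2]
  · intro τ hτ
    have hτ' := sphere_subset_closedBall hτ
    rw [Complex.add_re, hre τ hτ', Complex.sub_re, Complex.ofReal_re, Complex.re_ofReal_mul]
    have h1 := hc' τ (interior_subset (hball (hsub hτ')))
    rw [Complex.sq_norm_sub_eq τ c b, mem_sphere_iff_norm.1 hτ] at h1
    linarith

/-- The weak maximum principle for real parts of analytic functions, at the centre of a disc. -/
theorem re_le_re_center_of_sphere {F G : ℂ → ℂ} {c : ℂ} {r : ℝ} (hr : 0 < r)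
    (hF : AnalyticOnNhd ℂ F (closedBall c r)) (hG : AnalyticOnNhd ℂ G (closedBall c r))
    (hle : ∀ τ ∈ sphere c r, (F τ).re ≤ (G τ).re) : (F c).re ≤ (G c).re := by
  have hd : DiffContOnCl ℂ (fun τ => Complex.exp (F τ - G τ)) (ball c r) := by
    apply DifferentiableOn.diffContOnCl
    rw [closure_ball c hr.ne']
    exact ((hF.differentiableOn).sub hG.differentiableOn).cexp
  have := Complex.norm_le_of_forall_mem_frontier_norm_le isBounded_ball hd (C := 1)
    (z := c) ?_ (subset_closure (mem_ball_self hr))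
  · rw [Complex.norm_exp, Real.exp_le_one_iff, Complex.sub_re] at this
    linarith
  · intro z hz
    rw [frontier_ball c hr.ne'] at hz
    rw [Complex.norm_exp, Real.exp_le_one_iff, Complex.sub_re]
    linarith [hle z hz]

/-- For continuous functions this cuts the test down to discs, their centres and real parts of
analytic functions, the form that the Hartogs argument supplies. -/
theorem isSubharmonicOn_of_continuousOn {v : ℂ → ℝ} {V : Set ℂ} (hv : ContinuousOn v V)
    (hloc : ∀ (c : ℂ) (r : ℝ), 0 < r → closedBall c r ⊆ V →
      ∀ F : ℂ → ℂ, AnalyticOnNhd ℂ F (closedBall c r) →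
        (∀ τ ∈ sphere c r, v τ ≤ (F τ).re) → v c ≤ (F c).re) :
    IsSubharmonicOn (fun τ => (v τ : EReal)) V := by
  refine ⟨fun z _ => EReal.coe_lt_top _,
    (continuous_coe_real_ereal.comp_continuousOn hv).upperSemicontinuousOn, ?_⟩
  intro K hK hKV h hh hharm hfr z hz
  exact EReal.coe_le_coe_iff.2 <| le_harmonic_of_le_re_analytic hK (hv.mono hKV) hh hharm
    (fun c r hr hsub => hloc c r hr (hsub.trans hKV))
    (fun z hz => EReal.coe_le_coe_iff.1 (hfr z hz)) z hz

theorem isPlurisubharmonicOn_of_continuousOn {n : ℕ} {v : EuclideanSpace ℂ (Fin n) → ℝ}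
    {Ω : Set (EuclideanSpace ℂ (Fin n))} (hv : ContinuousOn v Ω)
    (hloc : ∀ (z w : EuclideanSpace ℂ (Fin n)) (c : ℂ) (r : ℝ), 0 < r →
      (∀ τ ∈ closedBall c r, z + τ • w ∈ Ω) →
      ∀ F : ℂ → ℂ, AnalyticOnNhd ℂ F (closedBall c r) →
        (∀ τ ∈ sphere c r, v (z + τ • w) ≤ (F τ).re) → v (z + c • w) ≤ (F c).re) :
    IsPlurisubharmonicOn (fun z => (v z : EReal)) Ω := by
  refine ⟨fun z _ => EReal.coe_lt_top _,
    (continuous_coe_real_ereal.comp_continuousOn hv).upperSemicontinuousOn, fun z w => ?_⟩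
  refine isSubharmonicOn_of_continuousOn (v := fun τ => v (z + τ • w)) ?_ ?_
  · exact hv.comp (by fun_prop) fun τ hτ => hτ
  · exact fun c r hr hsub => hloc z w c r hr fun τ hτ => hsub hτ

/-! ### Basic plurisubharmonic functions -/

/-- The norm is the supremum over the unit ball of the functions `Re ⟪e, ·⟫`, which are harmonic on
complex lines. -/
theorem isPlurisubharmonicOn_norm {n : ℕ} (Ω : Set (EuclideanSpace ℂ (Fin n))) :
    IsPlurisubharmonicOn (fun z => ((‖z‖ : ℝ) : EReal)) Ω := by
  refine isPlurisubharmonicOn_of_continuousOn continuous_norm.continuousOn ?_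
  intro z w c r hr _ F hF hle
  set x := z + c • w with hx
  have hFc : ∀ e : EuclideanSpace ℂ (Fin n), ‖e‖ ≤ 1 → (inner ℂ e x).re ≤ (F c).re := by
    intro e he
    refine re_le_re_center_of_sphere (F := fun τ => inner ℂ e (z + τ • w)) hr ?_ hF ?_
    · simp only [inner_add_right, inner_smul_right]
      exact fun τ _ => by fun_prop
    · intro τ hτ
      calc (inner ℂ e (z + τ • w)).re ≤ ‖inner ℂ e (z + τ • w)‖ := Complex.re_le_norm _
        _ ≤ ‖e‖ * ‖z + τ • w‖ := norm_inner_le_norm _ _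
        _ ≤ 1 * ‖z + τ • w‖ := by gcongr
        _ ≤ (F τ).re := by rw [one_mul]; exact hle τ hτ
  rcases eq_or_ne x 0 with h0 | h0
  · simpa [h0] using hFc 0 (by simp)
  · have := hFc (((‖x‖ : ℂ)⁻¹) • x) (by simp [norm_smul, h0])
    have h2 : inner ℂ (((‖x‖ : ℂ)⁻¹) • x) x = ((‖x‖ : ℝ) : ℂ) := by
      rw [inner_smul_left, inner_self_eq_norm_sq_to_K]
      have : (‖x‖ : ℂ) ≠ 0 := by simpa using h0
      simp
      field_simp
    rwa [h2, Complex.ofReal_re] at this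

theorem IsPlurisubharmonicOn.sup {n : ℕ} {u v : EuclideanSpace ℂ (Fin n) → EReal}
    {Ω : Set (EuclideanSpace ℂ (Fin n))} (hu : IsPlurisubharmonicOn u Ω)
    (hv : IsPlurisubharmonicOn v Ω) : IsPlurisubharmonicOn (fun z => max (u z) (v z)) Ω := by
  refine ⟨fun z hz => max_lt (hu.1 z hz) (hv.1 z hz), hu.2.1.sup hv.2.1, fun z w => ?_⟩
  obtain ⟨a1, a2, a3⟩ := hu.2.2 z w
  obtain ⟨b1, b2, b3⟩ := hv.2.2 z w
  refine ⟨fun τ hτ => max_lt (a1 τ hτ) (b1 τ hτ), a2.sup b2, ?_⟩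
  intro K hK hKV h hh hharm hfr τ hτ
  exact max_le (a3 K hK hKV h hh hharm (fun s hs => (le_max_left _ _).trans (hfr s hs)) τ hτ)
    (b3 K hK hKV h hh hharm (fun s hs => (le_max_right _ _).trans (hfr s hs)) τ hτ)

/-! ### Maximum principle on analytic discs -/

/-- If the graph of `u` is touched from above along an analytic curve, up to a strictly
superharmonic quadratic term, then `u` is not plurisubharmonic: the curve may be replaced by its
tangent line, since the remainder is harmonic up to `o(‖s‖ ^ 2)`. -/
theorem IsPlurisubharmonicOn.false_of_touching {n : ℕ} {u : EuclideanSpace ℂ (Fin n) → EReal}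
    {Ω : Set (EuclideanSpace ℂ (Fin n))} (hΩ : IsOpen Ω) (hu : IsPlurisubharmonicOn u Ω)
    {φ : ℂ → EuclideanSpace ℂ (Fin n)} {c t : ℂ} (hφ : AnalyticAt ℂ φ t)
    {x : EuclideanSpace ℂ (Fin n)} (hx : x ∈ Ω) {A k ε : ℝ} (hk : 0 < k) (hε : 0 < ε)
    (hux : u x = A)
    (hmax : ∀ᶠ p : EuclideanSpace ℂ (Fin n) × ℂ in 𝓝 (x, t),
      u p.1 ≤ ((A + ε * ‖t - c‖ ^ 2 - k * ‖x - φ t‖ ^ 2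
        - (ε * ‖p.2 - c‖ ^ 2 - k * ‖p.1 - φ p.2‖ ^ 2) : ℝ) : EReal)) : False := by
  set w := deriv φ t with hw
  set G : ℂ → EuclideanSpace ℂ (Fin n) := fun s => s • w - (φ (t + s) - φ t) with hG
  have hGo : ∀ᶠ s : ℂ in 𝓝 0, k * ‖G s‖ ^ 2 ≤ ε / 2 * ‖s‖ ^ 2 := by
    have hd := (hasDerivAt_iff_isLittleO_nhds_zero.1 hφ.differentiableAt.hasDerivAt)
    have hpos : 0 < Real.sqrt (ε / (2 * k)) := by positivity
    filter_upwards [hd.def hpos] with s hs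
    have h1 : ‖G s‖ ≤ Real.sqrt (ε / (2 * k)) * ‖s‖ := by
      rw [← norm_neg]
      simpa only [hG, neg_sub] using hs
    have h2 : ‖G s‖ ^ 2 ≤ (Real.sqrt (ε / (2 * k)) * ‖s‖) ^ 2 := by gcongr
    rw [mul_pow, Real.sq_sqrt (by positivity)] at h2
    calc k * ‖G s‖ ^ 2 ≤ k * (ε / (2 * k) * ‖s‖ ^ 2) := by gcongr
      _ = ε / 2 * ‖s‖ ^ 2 := by field_simp
  have hcurve : Tendsto (fun s : ℂ => (x + s • w, t + s)) (𝓝 0) (𝓝 (x, t)) := by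
    have : Continuous (fun s : ℂ => (x + s • w, t + s)) := by fun_prop
    simpa using this.tendsto 0
  have hGan : ∀ᶠ s : ℂ in 𝓝 0, AnalyticAt ℂ G s := by
    have h1 : Tendsto (fun s : ℂ => t + s) (𝓝 0) (𝓝 t) := by
      have : Continuous (fun s : ℂ => t + s) := by fun_prop
      simpa using this.tendsto 0
    filter_upwards [h1.eventually hφ.eventually_analyticAt] with s hs
    have h2 : AnalyticAt ℂ (fun s => φ (t + s)) s := hs.fun_comp (by fun_prop)
    have h3 : AnalyticAt ℂ (fun s : ℂ => s • w) s := by fun_prop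
    exact h3.sub (h2.sub analyticAt_const)
  have hin : ∀ᶠ s : ℂ in 𝓝 0, x + s • w ∈ Ω := by
    have h1 : Continuous (fun s : ℂ => x + s • w) := by fun_prop
    exact h1.continuousAt.eventually_mem (hΩ.mem_nhds (by simpa using hx))
  obtain ⟨ρ, hρ, hall⟩ := Metric.nhds_basis_closedBall.eventually_iff.1
    (((hcurve.eventually hmax).and hGo).and (hGan.and hin))
  -- Both squares are expanded along `(x + s • w, t + s)`: the cross terms are real parts of
  -- analytic functions, and `k * ‖G s‖ ^ 2` consumes only half of the gain `ε * ρ ^ 2`.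
  set Φ : ℂ → ℂ := fun s => ((A - ε / 2 * ρ ^ 2 : ℝ) : ℂ)
    - ((2 * ε : ℝ) : ℂ) * (starRingEnd ℂ (t - c) * s)
    + ((2 * k : ℝ) : ℂ) * inner ℂ (x - φ t) (G s) with hΦ
  have hΦan : ∀ s ∈ closedBall (0 : ℂ) ρ, AnalyticAt ℂ Φ s := by
    intro s hs
    have h1 : AnalyticAt ℂ (fun s => inner ℂ (x - φ t) (G s)) s :=
      ((innerSL ℂ (x - φ t)).analyticAt _).fun_comp (hall hs).2.1
    exact (AnalyticAt.sub analyticAt_const (by fun_prop)).add (analyticAt_const.mul h1)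
  have hG0 : G 0 = 0 := by simp [hG]
  have key := (hu.2.2 x w).2.2 (closedBall 0 ρ) (isCompact_closedBall _ _)
    (fun s hs => (hall hs).2.2) (fun s => (Φ s).re)
    (fun s hs => (Complex.continuous_re.continuousAt.comp (hΦan s hs).continuousAt).continuousWithinAt)
    (fun s hs => (hΦan s (interior_subset hs)).harmonicAt_re) ?_ 0 (mem_closedBall_self hρ.le)
  · simp only [zero_smul, add_zero, hux, hΦ, hG0, inner_zero_right, mul_zero, sub_zero,
      Complex.ofReal_re, EReal.coe_le_coe_iff] at key
    have : 0 < ε / 2 * ρ ^ 2 := by positivity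
    linarith
  · intro s hs
    rw [frontier_closedBall _ hρ.ne'] at hs
    obtain ⟨⟨h1, h2⟩, -⟩ := hall (sphere_subset_closedBall hs)
    refine h1.trans (EReal.coe_le_coe_iff.2 ?_)
    have hsρ : ‖s‖ = ρ := by simpa using hs
    have h3 := Complex.sq_norm_sub_eq (t + s) t c
    have h4 : x + s • w - φ (t + s) = (x - φ t) + G s := by simp only [hG]; abel
    have h5 := norm_add_sq (𝕜 := ℂ) (x - φ t) (G s)
    simp only [h4, h5, h3, hΦ, add_sub_cancel_left, Complex.add_re, Complex.sub_re,
      Complex.re_ofReal_mul, Complex.ofReal_re, hsρ] at h2 ⊢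
    simp only [RCLike.re_to_complex]
    linarith

/-- The maximum principle for a plurisubharmonic function on an analytic disc. -/
theorem IsPlurisubharmonicOn.le_of_le_on_sphere {n : ℕ} {u : EuclideanSpace ℂ (Fin n) → EReal}
    {Ω : Set (EuclideanSpace ℂ (Fin n))} (hΩ : IsOpen Ω) (hu : IsPlurisubharmonicOn u Ω)
    {φ : ℂ → EuclideanSpace ℂ (Fin n)} {c : ℂ} {r : ℝ} (hr : 0 < r)
    (hφ : AnalyticOnNhd ℂ φ (closedBall c r)) (hφΩ : ∀ τ ∈ closedBall c r, φ τ ∈ Ω)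
    {M : EReal} (hM : ∀ τ ∈ sphere c r, u (φ τ) ≤ M) :
    ∀ τ ∈ closedBall c r, u (φ τ) ≤ M := by
  suffices H : ∀ M : ℝ, (∀ τ ∈ sphere c r, u (φ τ) ≤ M) →
      ∀ τ ∈ closedBall c r, u (φ τ) ≤ M by
    intro τ hτ
    exact EReal.le_of_forall_lt_iff_le.1 fun M' hM' =>
      H M' (fun s hs => (hM s hs).trans hM'.le) τ hτ
  clear M hM
  intro M hM b hb
  by_contra! hlt
  -- Truncation at `M` removes the value `-∞`; where `v > M` nothing has changed.
  set v : EuclideanSpace ℂ (Fin n) → ℝ := fun z => (max (u z) M).toReal with hv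
  have hvu : ∀ z ∈ Ω, (v z : EReal) = max (u z) M := fun z hz =>
    EReal.coe_toReal (max_lt (hu.1 z hz) (EReal.coe_lt_top _)).ne
      ((EReal.bot_lt_coe M).trans_le (le_max_right _ _)).ne'
  have husc : UpperSemicontinuousOn v Ω := by
    intro z hz y hy
    have hy' : max (u z) (M : EReal) < y := by
      rw [← hvu z hz]; exact_mod_cast hy
    filter_upwards [hu.2.1 z hz y ((le_max_left _ _).trans_lt hy'), self_mem_nhdsWithin]
      with a ha haΩ
    have : (v a : EReal) < y := by
      rw [hvu a haΩ]; exact max_lt ha ((le_max_right _ _).trans_lt hy')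
    exact_mod_cast this
  set C := closedBall c r with hC
  have hCc : IsCompact C := isCompact_closedBall _ _
  have hφc : ContinuousOn φ C := hφ.continuousOn
  set m := v (φ b) - M with hm
  have hm0 : 0 < m := by
    have : (M : EReal) < v (φ b) := by
      rw [hvu _ (hφΩ b hb)]; exact hlt.trans_le (le_max_left _ _)
    exact sub_pos.2 (by exact_mod_cast this)
  obtain ⟨δ, hδ, hδΩ⟩ := (hCc.image_of_continuousOn hφc).exists_cthickening_subset_open hΩ
    (image_subset_iff.2 hφΩ)
  set W := cthickening δ (φ '' C) with hW
  have hWc : IsCompact W := (hCc.image_of_continuousOn hφc).cthickening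
  have hSopen : IsOpen {z ∈ Ω | v z < M + m / 2} := by
    rw [isOpen_iff_mem_nhds]
    rintro z ⟨hz, hvz⟩
    have := husc z hz _ hvz
    rw [hΩ.nhdsWithin_eq hz] at this
    filter_upwards [this, hΩ.mem_nhds hz] with a ha ha' using ⟨ha', ha⟩
  obtain ⟨δ', hδ', hδS⟩ := ((isCompact_sphere c r).image_of_continuousOn
      (hφc.mono sphere_subset_closedBall)).exists_thickening_subset_open hSopen (by
    rintro _ ⟨τ, hτ, rfl⟩
    have h1 := hφΩ τ (sphere_subset_closedBall hτ)
    refine ⟨h1, ?_⟩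
    have h2 : (v (φ τ) : EReal) ≤ M := by rw [hvu _ h1]; exact max_le (hM τ hτ) le_rfl
    have h3 : v (φ τ) ≤ M := by exact_mod_cast h2
    change v (φ τ) < M + m / 2
    linarith)
  have hφW : ∀ τ ∈ C, φ τ ∈ W := fun τ hτ => self_subset_cthickening _ (mem_image_of_mem φ hτ)
  obtain ⟨q, -, hq⟩ := (husc.mono hδΩ).exists_isMaxOn ⟨φ b, hφW b hb⟩ hWc
  have hq' : ∀ z ∈ W, v z ≤ v q := hq
  set η := min δ δ' with hη
  have hη0 : 0 < η := lt_min hδ hδ'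
  -- The term in `ε` is at most `m / 4` on the disc, so the maximum below is attained where `v x > M
  -- + m / 2`, away from the boundary curve.
  set ε := m / (4 * r ^ 2) with hε
  have hε0 : 0 < ε := by positivity
  have hεr : ε * r ^ 2 = m / 4 := by rw [hε]; field_simp
  -- At distance `η` the penalty is `v q - M + 1`, too large for a maximum; hence `‖x - φ t‖ < η`.
  set k := (v q - M) / η ^ 2 + 1 / η ^ 2 with hk
  have hqM : M + m ≤ v q := by have := hq' _ (hφW b hb); linarith
  have hk0 : 0 < k := by
    have : 0 ≤ v q - M := by linarith
    positivity
  have hkη : k * η ^ 2 = v q - M + 1 := by rw [hk]; field_simp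
  have hΨ : UpperSemicontinuousOn (fun p : EuclideanSpace ℂ (Fin n) × ℂ =>
      v p.1 + (ε * ‖p.2 - c‖ ^ 2 - k * ‖p.1 - φ p.2‖ ^ 2)) (W ×ˢ C) := by
    refine UpperSemicontinuousOn.add ?_ (ContinuousOn.upperSemicontinuousOn ?_)
    · exact (husc.mono hδΩ).comp continuousOn_fst fun p hp => hp.1
    · have : ContinuousOn (fun p : EuclideanSpace ℂ (Fin n) × ℂ => φ p.2) (W ×ˢ C) :=
        hφc.comp continuousOn_snd fun p hp => hp.2
      exact (Continuous.continuousOn (by fun_prop)).sub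
        (continuousOn_const.mul ((continuousOn_fst.sub this).norm.pow 2))
  obtain ⟨⟨x, t⟩, ⟨hxW, htC⟩, hmax⟩ :=
    hΨ.exists_isMaxOn ⟨(φ b, b), mk_mem_prod (hφW b hb) hb⟩ (hWc.prod hCc)
  have hmax' : ∀ z ∈ W, ∀ τ ∈ C, v z + (ε * ‖τ - c‖ ^ 2 - k * ‖z - φ τ‖ ^ 2) ≤
      v x + (ε * ‖t - c‖ ^ 2 - k * ‖x - φ t‖ ^ 2) := fun z hz τ hτ =>
    hmax (a := (z, τ)) ⟨hz, hτ⟩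
  simp only at hxW htC
  have hb1 := hmax' _ (hφW b hb) b hb
  simp only [sub_self, norm_zero] at hb1
  have hb2 : 0 ≤ ε * ‖b - c‖ ^ 2 := by positivity
  have htr : ε * ‖t - c‖ ^ 2 ≤ m / 4 := by
    have h1 : ‖t - c‖ ≤ r := by simpa [hC, dist_eq_norm] using htC
    rw [← hεr]; gcongr
  have hdist : ‖x - φ t‖ < η := by
    by_contra! hge
    have h1 : k * η ^ 2 ≤ k * ‖x - φ t‖ ^ 2 := by gcongr
    have h2 := hq' x hxW
    linarith
  have hkx : 0 ≤ k * ‖x - φ t‖ ^ 2 := by positivity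
  have hvx : M + m / 2 < v x := by linarith
  have hxint : W ∈ 𝓝 x := by
    have h1 : x ∈ thickening δ (φ '' C) := mem_thickening_iff.2
      ⟨φ t, mem_image_of_mem φ htC, by
        rw [dist_eq_norm]; exact hdist.trans_le (min_le_left _ _)⟩
    exact mem_of_superset (isOpen_thickening.mem_nhds h1) (thickening_subset_cthickening _ _)
  have htint : C ∈ 𝓝 t := by
    rcases (mem_closedBall.1 htC).lt_or_eq with h1 | h1
    · exact mem_of_superset (isOpen_ball.mem_nhds h1) ball_subset_closedBall
    · exfalso
      have h2 : x ∈ thickening δ' (φ '' sphere c r) := mem_thickening_iff.2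
        ⟨φ t, mem_image_of_mem φ h1, by
          rw [dist_eq_norm]; exact hdist.trans_le (min_le_right _ _)⟩
      exact lt_asymm hvx (hδS h2).2
  have hux : u x = v x := by
    have h1 := hvu x (hδΩ hxW)
    rcases max_choice (u x) (M : EReal) with h2 | h2
    · rw [h1, h2]
    · rw [h2] at h1
      have : v x = M := by exact_mod_cast h1
      linarith
  refine hu.false_of_touching hΩ (hφ t htC) (hδΩ hxW) (c := c) hk0 hε0 hux ?_
  filter_upwards [prod_mem_nhds hxint htint] with p hp
  have h1 := hmax' p.1 hp.1 p.2 hp.2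
  have h2 : u p.1 ≤ v p.1 := by rw [hvu _ (hδΩ hp.1)]; exact le_max_left _ _
  refine h2.trans (EReal.coe_le_coe_iff.2 ?_)
  linarith

/-! ### Distance to the complement and Hartogs discs -/

theorem infDist_compl_pos {X : Type*} [PseudoMetricSpace X] {Ω : Set X} (hΩ : IsOpen Ω)
    (hne : Ω ≠ univ) {z : X} (hz : z ∈ Ω) : 0 < infDist z Ωᶜ :=
  (hΩ.isClosed_compl.notMem_iff_infDist_pos (nonempty_compl.2 hne)).1 (not_not.2 hz)

theorem mem_of_dist_lt_infDist_compl {X : Type*} [PseudoMetricSpace X] {Ω : Set X} {z y : X}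
    (h : dist z y < infDist z Ωᶜ) : y ∈ Ω := by
  by_contra hy
  exact absurd (infDist_le_dist_of_mem (s := Ωᶜ) (x := z) hy) (not_le.2 h)

theorem continuousOn_negLogDistCompl {n : ℕ} {Ω : Set (EuclideanSpace ℂ (Fin n))}
    (hΩ : IsOpen Ω) (hne : Ω ≠ univ) : ContinuousOn (negLogDistCompl Ω) Ω :=
  (ContinuousOn.log (continuous_infDist_pt _).continuousOn
    fun _ hz => (infDist_compl_pos hΩ hne hz).ne').neg

/-- If hulls of compact sets are relatively compact, analytic discs cannot leave `Ω` through their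
interior, which bounds the distance to the complement from below. -/
theorem negLogDistCompl_le_re_of_hull {n : ℕ} {Ω : Set (EuclideanSpace ℂ (Fin n))}
    (hΩ : IsOpen Ω) (hne : Ω ≠ univ)
    (hull : ∀ K : Set (EuclideanSpace ℂ (Fin n)), IsCompact K → K ⊆ Ω →
      IsRelativelyCompactIn (plurisubharmonicHull Ω K) Ω)
    (z w : EuclideanSpace ℂ (Fin n)) {c : ℂ} {r : ℝ} (hr : 0 < r)
    (hdisc : ∀ τ ∈ closedBall c r, z + τ • w ∈ Ω) {F : ℂ → ℂ}
    (hF : AnalyticOnNhd ℂ F (closedBall c r))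
    (hle : ∀ τ ∈ sphere c r, negLogDistCompl Ω (z + τ • w) ≤ (F τ).re) :
    negLogDistCompl Ω (z + c • w) ≤ (F c).re := by
  have main : ∀ a : EuclideanSpace ℂ (Fin n), ‖a‖ < 1 →
      z + c • w + Complex.exp (-F c) • a ∈ Ω := by
    intro a ha
    set φ : ℝ → ℂ → EuclideanSpace ℂ (Fin n) :=
      fun l τ => z + τ • w + Complex.exp (-F τ) • (l • a) with hφ
    have hφan : ∀ l, AnalyticOnNhd ℂ (φ l) (closedBall c r) := by
      intro l τ hτ
      have h1 := hF τ hτ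
      exact AnalyticAt.add (by fun_prop) (h1.neg.cexp.smul analyticAt_const)
    have hφc : ∀ p ∈ univ ×ˢ closedBall c r,
        ContinuousAt (fun p : ℝ × ℂ => φ p.1 p.2) p := by
      rintro ⟨l, τ⟩ ⟨-, hτ⟩
      have h1 : ContinuousAt (fun p : ℝ × ℂ => F p.2) (l, τ) :=
        ContinuousAt.comp (g := F) (hF τ hτ).continuousAt continuousAt_snd
      exact (Continuous.continuousAt (by fun_prop)).add
        (h1.neg.cexp.smul (Continuous.continuousAt (by fun_prop)))
    have hφs : ∀ l ∈ Icc (0 : ℝ) 1, ∀ τ ∈ sphere c r, φ l τ ∈ Ω := by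
      intro l hl τ hτ
      have hpos := infDist_compl_pos hΩ hne (hdisc τ (sphere_subset_closedBall hτ))
      have hexp : Real.exp (-(F τ).re) ≤ infDist (z + τ • w) Ωᶜ := by
        rw [← Real.exp_log hpos, Real.exp_le_exp]
        have := hle τ hτ
        rw [negLogDistCompl] at this
        linarith
      refine mem_of_dist_lt_infDist_compl (z := z + τ • w) (lt_of_lt_of_le ?_ hexp)
      rw [hφ, dist_self_add_right, norm_smul, Complex.norm_exp, Complex.neg_re, norm_smul,
        Real.norm_of_nonneg hl.1]
      have : l * ‖a‖ < 1 := by nlinarith [hl.1, hl.2, norm_nonneg a]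
      exact mul_lt_of_lt_one_right (Real.exp_pos _) this
    set K := (fun p : ℝ × ℂ => φ p.1 p.2) '' (Icc (0 : ℝ) 1 ×ˢ sphere c r) with hK
    have hKc : IsCompact K := (isCompact_Icc.prod (isCompact_sphere c r)).image_of_continuousOn
      fun p hp => (hφc p ⟨mem_univ _, sphere_subset_closedBall hp.2⟩).continuousWithinAt
    have hKΩ : K ⊆ Ω := by
      rintro _ ⟨⟨l, τ⟩, ⟨hl, hτ⟩, rfl⟩
      exact hφs l hl τ hτ
    obtain ⟨-, hLΩ⟩ := hull K hKc hKΩ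
    set L := closure (plurisubharmonicHull Ω K) with hL
    have hstep : ∀ l ∈ Icc (0 : ℝ) 1, (∀ τ ∈ closedBall c r, φ l τ ∈ Ω) →
        ∀ τ ∈ closedBall c r, φ l τ ∈ L := by
      intro l hl hin τ hτ
      refine subset_closure ⟨hin τ hτ, fun u hu => ?_⟩
      exact hu.le_of_le_on_sphere hΩ hr (hφan l) hin
        (fun s hs => le_iSup₂ (f := fun x (_ : x ∈ K) => u x) (φ l s) ⟨(l, s), ⟨hl, hs⟩, rfl⟩) τ hτ
    have hopen : IsOpen {l : ℝ | ∀ τ ∈ closedBall c r, φ l τ ∈ Ω} := by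
      rw [isOpen_iff_mem_nhds]
      intro l hl
      refine (isCompact_closedBall c r).eventually_forall_of_forall_eventually fun τ hτ => ?_
      exact (hφc (l, τ) ⟨mem_univ _, hτ⟩).eventually_mem (hΩ.mem_nhds (hl τ hτ))
    have hclosed : IsClosed {l : ℝ | ∀ τ ∈ closedBall c r, φ l τ ∈ L} := by
      simp only [ofPred_forall]
      refine isClosed_biInter fun τ _ => isClosed_closure.preimage ?_
      simp only [hφ]; fun_prop
    -- Membership in `Ω` gives openness, membership in `L ⊆ Ω` closedness; `hstep` makes the two
    -- conditions equivalent, and `unitInterval` is connected.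
    set S := {l : unitInterval | ∀ τ ∈ closedBall c r, φ l τ ∈ Ω} with hS
    have hSeq : S = {l : unitInterval | ∀ τ ∈ closedBall c r, φ l τ ∈ L} :=
      Subset.antisymm (fun l hl => hstep l l.2 hl) fun l hl τ hτ => hLΩ (hl τ hτ)
    have hclopen : IsClopen S :=
      ⟨hSeq ▸ hclosed.preimage continuous_subtype_val, hopen.preimage continuous_subtype_val⟩
    have hSuniv : S = univ := hclopen.eq_univ ⟨0, fun τ hτ => by simpa [hφ] using hdisc τ hτ⟩
    have h1 : (1 : unitInterval) ∈ S := hSuniv ▸ mem_univ _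
    simpa [hφ] using h1 c (mem_closedBall_self hr.le)
  have hpos := infDist_compl_pos hΩ hne (hdisc c (mem_closedBall_self hr.le))
  have hd : Real.exp (-(F c).re) ≤ infDist (z + c • w) Ωᶜ := by
    refine (le_infDist (nonempty_compl.2 hne)).2 fun y hy => ?_
    by_contra! hlt
    refine hy ?_
    have h0 := Complex.exp_ne_zero (-F c)
    have := main ((Complex.exp (-F c))⁻¹ • (y - (z + c • w))) (by
      rw [norm_smul, norm_inv, Complex.norm_exp, Complex.neg_re, inv_mul_lt_one₀ (Real.exp_pos _),
        ← dist_eq_norm, dist_comm]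
      exact hlt)
    rwa [smul_inv_smul₀ h0, add_sub_cancel] at this
  rw [negLogDistCompl, neg_le, ← Real.exp_le_exp, Real.exp_log hpos]
  exact hd

/-! ### Exhaustions, hulls and the equivalence -/

/-- In the maximum, `‖z‖` keeps sublevel sets bounded and `-log d` keeps them at distance at least
`exp (-c)` from the complement. -/
theorem exists_exhaustion_of_negLogDistCompl {n : ℕ} {Ω : Set (EuclideanSpace ℂ (Fin n))}
    (hΩ : IsOpen Ω) (hne : Ω ≠ univ)
    (h : IsPlurisubharmonicOn (fun z => (negLogDistCompl Ω z : EReal)) Ω) :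
    ∃ u : EuclideanSpace ℂ (Fin n) → ℝ,
      ContinuousOn u Ω ∧ IsPlurisubharmonicOn (fun z => (u z : EReal)) Ω ∧
        ∀ c : ℝ, IsRelativelyCompactIn {z ∈ Ω | u z < c} Ω := by
  refine ⟨fun z => max (negLogDistCompl Ω z) ‖z‖,
    (continuousOn_negLogDistCompl hΩ hne).sup continuous_norm.continuousOn, ?_, fun c => ?_⟩
  · simpa only [EReal.coe_strictMono.monotone.map_max] using
      h.sup (isPlurisubharmonicOn_norm Ω)
  · have hsub : closure {z ∈ Ω | max (negLogDistCompl Ω z) ‖z‖ < c} ⊆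
        {z | Real.exp (-c) ≤ infDist z Ωᶜ} ∩ closedBall 0 c := by
      refine closure_minimal ?_ ((isClosed_le continuous_const (continuous_infDist_pt _)).inter
        isClosed_closedBall)
      rintro z ⟨hz, hzc⟩
      obtain ⟨h1, h2⟩ := max_lt_iff.1 hzc
      refine ⟨?_, by simpa using h2.le⟩
      rw [negLogDistCompl, neg_lt] at h1
      exact (Real.exp_le_exp.2 h1.le).trans_eq (Real.exp_log (infDist_compl_pos hΩ hne hz))
    refine ⟨(isCompact_closedBall 0 c).of_isClosed_subset isClosed_closure
      (hsub.trans inter_subset_right), fun z hz => ?_⟩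
    exact mem_of_dist_lt_infDist_compl (z := z)
      (by rw [dist_self]; exact (Real.exp_pos _).trans_le (hsub hz).1)

theorem isRelativelyCompactIn_hull_of_exhaustion {n : ℕ} {Ω : Set (EuclideanSpace ℂ (Fin n))}
    {u : EuclideanSpace ℂ (Fin n) → ℝ} (hc : ContinuousOn u Ω)
    (hu : IsPlurisubharmonicOn (fun z => (u z : EReal)) Ω)
    (hex : ∀ c : ℝ, IsRelativelyCompactIn {z ∈ Ω | u z < c} Ω)
    {K : Set (EuclideanSpace ℂ (Fin n))} (hK : IsCompact K) (hKΩ : K ⊆ Ω) :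
    IsRelativelyCompactIn (plurisubharmonicHull Ω K) Ω := by
  obtain ⟨B, hB⟩ := hK.bddAbove_image (hc.mono hKΩ)
  have hsub : closure (plurisubharmonicHull Ω K) ⊆ closure {z ∈ Ω | u z < B + 1} := by
    refine closure_mono fun z hz => ⟨hz.1, ?_⟩
    have h1 : (u z : EReal) ≤ B := (hz.2 _ hu).trans <|
      iSup₂_le fun x hx => EReal.coe_le_coe_iff.2 (hB (mem_image_of_mem u hx))
    have h2 : u z ≤ B := EReal.coe_le_coe_iff.1 h1
    linarith
  exact ⟨(hex _).1.of_isClosed_subset isClosed_closure hsub, hsub.trans (hex _).2⟩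

theorem theorem2p6p7 (n : ℕ) (Ω : Set (EuclideanSpace ℂ (Fin n)))
    (hΩ : IsOpen Ω) (hne : Ω ≠ Set.univ) :
    List.TFAE [
      IsPlurisubharmonicOn (fun z => (negLogDistCompl Ω z : EReal)) Ω,
      ∃ u : EuclideanSpace ℂ (Fin n) → ℝ,
        ContinuousOn u Ω ∧ IsPlurisubharmonicOn (fun z => (u z : EReal)) Ω ∧
          ∀ c : ℝ, IsRelativelyCompactIn {z ∈ Ω | u z < c} Ω,
      ∀ K : Set (EuclideanSpace ℂ (Fin n)), IsCompact K → K ⊆ Ω →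
        IsRelativelyCompactIn (plurisubharmonicHull Ω K) Ω,
      IsPseudoconvex Ω] := by
  tfae_have 1 → 2 := exists_exhaustion_of_negLogDistCompl hΩ hne
  tfae_have 2 → 3 := fun ⟨u, hc, hu, hex⟩ K hK hKΩ =>
    isRelativelyCompactIn_hull_of_exhaustion hc hu hex hK hKΩ
  tfae_have 3 → 1 := fun hull =>
    isPlurisubharmonicOn_of_continuousOn (continuousOn_negLogDistCompl hΩ hne)
      fun z w _ _ hr hdisc _ hF hle =>
        negLogDistCompl_le_re_of_hull hΩ hne hull z w hr hdisc hF hle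
  tfae_have 1 ↔ 4 := ⟨fun h => ⟨hΩ, Or.inr h⟩, fun h => h.2.resolve_left hne⟩
  tfae_finish
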